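/- Let $G$ be a finite group with a homomorphism $s: G\to\{1,-1\}$; the elements with $s(g)=-1$ are called anti-unitary (there may be none). Put $\kappa_{1}=\mathrm{id}$ and let $\kappa_{-1}=\kappa$ be complex conjugation. Let $\omega: G\times G\to U(1)$ be a factor system, i.e. $\omega(g_1,g_2)\,\omega(g_1g_2,g_3)=\omega(g_2,g_3)^{s(g_1)}\,\omega(g_1,g_2g_3)$ for all $g_1,g_2,g_3\in G$. A unitary projective (co-)representation of $G$ of dimension $n$ with factor system $\omega$ is a family of unitary $n\times n$ matrices $M(g)$, $g\in G$, with $M(g_1)\kappa_{s(g_1)}M(g_2)\kappa_{s(g_2)}=\omega(g_1,g_2)\,M(g_1g_2)\kappa_{s(g_1g_2)}$ as operators on $\mathbb C^n$. It is irreducible if $n\ge 1$ and the only complex subspaces of $\mathbb C^n$ invariant under all operators $M(g)\kappa_{s(g)}$ are $0$ and $\mathbb C^n$. Let $M$ be such a (co-)representation, of dimension $d$. For a complex $d\times d$ matrix $X$ let $$\mathscr H_X=\sum_{g\in G}\big[M(g)\kappa_{s(g)}\big]\,(X+X^\dagger)\,\big[M(g)\kappa_{s(g)}\big]^{-1}.$$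 (1) For every $X$, the matrix $\mathscr H_X$ is Hermitian and commutes with every operator $M(g)\kappa_{s(g)}$, $g\in G$. (2) For all $X\in\mathbb C^{d\times d}$ outside a set of Lebesgue measure zero, the following holds. For every eigenvalue $\mu$ of $\mathscr H_X$ and every orthonormal basis $b_1,\dots,b_k$ of the corresponding eigenspace, there is an irreducible unitary projective (co-)representation $N$ of $G$ of dimension $k$, with the same factor system $\omega$, such that $M(g)\kappa_{s(g)}\,b_j=\sum_{i=1}^k N(g)_{ij}\,b_i$ for all $g\in G$ and $1\le j\le k$, and $N$ is contained in $M$: there are a unitary matrix $U$ and a unitary projective (co-)representation $N'$ with factor system $\omega$ (possibly of dimension $0$) such that $U^{-1}M(g)\kappa_{s(g)}U=\big(N(g)\oplus N'(g)\big)\kappa_{s(g)}$ for all $g\in G$. -/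

import Mathlib

/-- `κ_ε`: the identity of `ℂ` if `ε = 1`, complex conjugation if `ε = -1`. -/
noncomputable def kappa (ε : ℤˣ) : ℂ ≃ₐ[ℝ] ℂ :=
  if ε = 1 then AlgEquiv.refl else Complex.conjAe

theorem kappa_kappa (ε : ℤˣ) (z : ℂ) : kappa ε (kappa ε z) = z := by
  unfold kappa
  split_ifs <;> simp

theorem kappa_smul (ε : ℤˣ) (r : ℝ) (z : ℂ) : kappa ε (r • z) = r • kappa ε z := by
  unfold kappa
  split_ifs <;> simp

/-- A factor system of the group `G`, whose anti-unitary elements are the `g` with `s g = -1`: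
phases `ω(g₁, g₂)` with the twisted cocycle condition. -/
structure FactorSystem {G : Type*} [Group G] (s : G →* ℤˣ) where
  toFun : G → G → Circle
  cocycle : ∀ g₁ g₂ g₃ : G,
    toFun g₁ g₂ * toFun (g₁ * g₂) g₃ = toFun g₂ g₃ ^ (s g₁ : ℤ) * toFun g₁ (g₂ * g₃)

/-- A unitary projective (co-)representation of `G` with factor system `ω` on `ℂⁿ`:
unitary matrices `M(g)` with `M(g₁)κ_{s(g₁)} M(g₂)κ_{s(g₂)} = ω(g₁,g₂) M(g₁g₂)κ_{s(g₁g₂)}`. -/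
structure UnitaryCoRep {G : Type*} [Group G] {s : G →* ℤˣ} (ω : FactorSystem s)
    (n : Type*) [Fintype n] [DecidableEq n] where
  mat : G → Matrix n n ℂ
  unitary : ∀ g, mat g ∈ Matrix.unitaryGroup n ℂ
  mul_kappa : ∀ g₁ g₂,
    mat g₁ * (mat g₂).map (kappa (s g₁)) = (ω.toFun g₁ g₂ : ℂ) • mat (g₁ * g₂)

namespace UnitaryCoRep

variable {G : Type*} [Group G] {s : G →* ℤˣ} {ω : FactorSystem s}
  {n : Type*} [Fintype n] [DecidableEq n]

/-- The invertible (linear or antilinear) operator `M(g)κ_{s(g)}` on `ℂⁿ`. -/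
noncomputable def op (M : UnitaryCoRep ω n) (g : G) :
    EuclideanSpace ℂ n ≃ₗ[ℝ] EuclideanSpace ℂ n where
  toFun v := WithLp.toLp 2 (Matrix.mulVec (M.mat g) fun i => kappa (s g) (v i))
  invFun v := WithLp.toLp 2 fun i => kappa (s g) (Matrix.mulVec (M.mat g)⁻¹ v.ofLp i)
  map_add' v w := by
    ext i
    simp [Matrix.mulVec, dotProduct, mul_add, Finset.sum_add_distrib]
  map_smul' r v := by
    ext i
    simp only [Matrix.mulVec, dotProduct, PiLp.smul_apply, Finset.smul_sum, RingHom.id_apply]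
    exact Finset.sum_congr rfl fun j _ =>
      (congrArg (M.mat g i j * ·) (kappa_smul (s g) r (v j))).trans (mul_smul_comm _ _ _)
  left_inv v := by
    have h : IsUnit (M.mat g).det := Matrix.UnitaryGroup.det_isUnit ⟨_, M.unitary g⟩
    ext i
    simp [Matrix.mulVec_mulVec, Matrix.nonsing_inv_mul _ h, kappa_kappa]
  right_inv v := by
    have h : IsUnit (M.mat g).det := Matrix.UnitaryGroup.det_isUnit ⟨_, M.unitary g⟩
    ext i
    simp [Matrix.mulVec_mulVec, Matrix.mul_nonsing_inv _ h, kappa_kappa]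

/-- The matrix of the complex linear operator `[M(g)κ_{s(g)}] A [M(g)κ_{s(g)}]⁻¹`. -/
noncomputable def conjBy (M : UnitaryCoRep ω n) (g : G) (A : Matrix n n ℂ) : Matrix n n ℂ :=
  M.mat g * A.map (kappa (s g)) * (M.mat g)⁻¹

theorem conjBy_apply (M : UnitaryCoRep ω n) (g : G) (A : Matrix n n ℂ) (v : EuclideanSpace ℂ n) :
    Matrix.toEuclideanLin (M.conjBy g A) v =
      M.op g (Matrix.toEuclideanLin A ((M.op g).symm v)) := by
  ext i
  simp only [conjBy, op, Matrix.toLpLin_apply, LinearEquiv.coe_mk, LinearMap.coe_mk,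
    AddHom.coe_mk, LinearEquiv.coe_symm_mk, ← Matrix.mulVec_mulVec]
  congr 2
  funext j
  simp [Matrix.mulVec, dotProduct, kappa_kappa]

/-- `ℋ = ∑_g [M(g)κ_{s(g)}] (X + X†) [M(g)κ_{s(g)}]⁻¹`. -/
noncomputable def hamiltonian [Fintype G] (M : UnitaryCoRep ω n) (X : Matrix n n ℂ) :
    Matrix n n ℂ :=
  ∑ g : G, M.conjBy g (X + X.conjTranspose)

/-- `M` is irreducible: the space is nonzero and no complex subspace other than `0` and the
whole space is invariant under all `M(g)κ_{s(g)}`. -/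
def IsIrreducible (M : UnitaryCoRep ω n) : Prop :=
  Nonempty n ∧ ∀ W : Submodule ℂ (EuclideanSpace ℂ n),
    (∀ g, ∀ v ∈ W, M.op g v ∈ W) → W = ⊥ ∨ W = ⊤

/-- `N` is contained in `M`: for some unitary `U` and some unitary projective
(co-)representation `N'` with the same factor system (possibly of dimension `0`),
`U⁻¹ M(g)κ_{s(g)} U = (N(g) ⊕ N'(g))κ_{s(g)}` for all `g`. -/
def IsContainedIn {m : Type*} [Fintype m] [DecidableEq m]
    (N : UnitaryCoRep ω m) (M : UnitaryCoRep ω n) : Prop :=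
  ∃ (l : ℕ) (N' : UnitaryCoRep ω (Fin l)) (U : Matrix n (m ⊕ Fin l) ℂ),
    U.conjTranspose * U = 1 ∧ U * U.conjTranspose = 1 ∧
    ∀ g, M.mat g * U.map (kappa (s g)) = U * Matrix.fromBlocks (N.mat g) 0 0 (N'.mat g)

end UnitaryCoRep

/-!
Whether a Hermitian matrix has at least `r` distinct eigenvalues is decided by the nonvanishing of
a homogeneous polynomial in its entries, the Gram determinant of its first `r` powers. As `ℋ_X` is
real linear in `X`, for almost every `X` the number of distinct eigenvalues of `ℋ_X` is therefore
the largest one possible. For such `X` every eigenspace is a minimal invariant subspace: if `W`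
were a nonzero invariant subspace properly contained in the eigenspace of `μ`, then adding
`c • P_W`, with `P_W` the orthogonal projection and `c` a generic real number, would split `μ` into
`μ` and `μ + c` and keep all other eigenvalues; but `ℋ_X + c • P_W` is again of the form `ℋ_Y`,
because the matrices `ℋ_Y` are exactly the Hermitian matrices commuting with all operators
`M(g)κ_{s(g)}`. The complementary summand of `M` acts on the orthogonal complement of the
eigenspace, which is again invariant.
-/

section PolynomialOnLines

open MeasureTheory Polynomial

theorem ae_ne_zero_of_homogeneous_of_polynomial_on_lines {E K : Type*}
    [NormedAddCommGroup E] [NormedSpace ℝ E] [FiniteDimensional ℝ E]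
    [MeasurableSpace E] [BorelSpace E] (ν : Measure E) [ν.IsAddHaarMeasure]
    [CommRing K] [IsDomain K] [Algebra ℝ K] {f : E → K} {N : ℕ} {v : E}
    (hmeas : MeasurableSet {x | f x ≠ 0})
    (hhom : ∀ (c : ℝ) x, f (c • x) = algebraMap ℝ K c ^ N * f x)
    (hpoly : ∀ x y, ∃ p : K[X], ∀ t : ℝ, p.eval (algebraMap ℝ K t) = f (x + t • y))
    (hv : f v ≠ 0) : ∀ᵐ x ∂ν, f x ≠ 0 := by
  refine ae_mem_of_ae_add_linearMap_mem (s := {x | f x ≠ 0}) (LinearMap.toSpanSingleton ℝ E v)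
    volume ν hmeas fun x => ?_
  obtain ⟨p, hp⟩ := hpoly v x
  have hp0 : p ≠ 0 := by
    rintro rfl
    exact hv (by simpa using (hp 0).symm)
  have hroots : {t : ℝ | p.IsRoot (algebraMap ℝ K t⁻¹)}.Finite :=
    (finite_setOfPred_isRoot hp0).preimage
      ((FaithfulSMul.algebraMap_injective ℝ K).comp inv_injective).injOn
  -- `f (v + t⁻¹ • x) = t⁻¹ ^ N * f (x + t • v)`, so nonzero zeros are inverses of roots of `p`.
  have hzeros : ∀ t : ℝ, f (x + t • v) = 0 → t = 0 ∨ p.IsRoot (algebraMap ℝ K t⁻¹) := by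
    refine fun t ht => or_iff_not_imp_left.2 fun ht0 => ?_
    have hscale : t⁻¹ • (x + t • v) = v + t⁻¹ • x := by
      rw [smul_add, smul_smul, inv_mul_cancel₀ ht0, one_smul, add_comm]
    rw [IsRoot.def, hp, ← hscale, hhom, ht, mul_zero]
  have hfin : {t : ℝ | f (x + t • v) = 0}.Finite := (hroots.insert 0).subset hzeros
  simpa [ae_iff] using hfin.measure_zero volume

end PolynomialOnLines

section TracePowDet

open Matrix

theorem injective_rectVandermonde_mulVec_iff {K α : Type*} [Field K] [Finite α] (v : α → K)
    (r : ℕ) : Function.Injective (rectVandermonde v 1 r).mulVec ↔ r ≤ (Set.range v).ncard := by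
  have := Fintype.ofFinite (Set.range v)
  rw [Set.ncard_eq_toFinset_card', Set.toFinset_card]
  constructor
  · intro hinj
    let W : Matrix (Set.range v) (Fin r) K := rectVandermonde (↑) 1 r
    have hW : Function.Injective W.mulVecLin := fun c c' h =>
      hinj (funext fun i => congrFun h ⟨v i, i, rfl⟩)
    simpa only [Fintype.card_fin] using card_le_of_injective K W.mulVecLin hW
  · intro h
    obtain ⟨e⟩ : Nonempty (Fin r ↪ Set.range v) :=
      Function.Embedding.nonempty_of_card_le (by rwa [Fintype.card_fin])
    choose i hi using fun j => (e j).2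
    have hdet : (vandermonde (v ∘ i)).det ≠ 0 := by
      rw [det_vandermonde_ne_zero_iff]
      intro j j' hj
      simp only [Function.comp_apply, hi] at hj
      exact e.injective (Subtype.ext hj)
    intro c c' hc
    refine mulVec_injective_of_isUnit ((isUnit_iff_isUnit_det _).2 hdet.isUnit) (funext fun j => ?_)
    simpa [mulVec, dotProduct, rectVandermonde_apply] using congrFun hc (i j)

theorem det_transpose_mul_self_ne_zero_iff {m n : Type*} [Fintype m] [Fintype n] [DecidableEq n]
    (A : Matrix m n ℝ) : (Aᵀ * A).det ≠ 0 ↔ Function.Injective A.mulVec := by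
  rw [← isUnit_iff_ne_zero, ← isUnit_iff_isUnit_det, ← mulVec_injective_iff_isUnit]
  change Function.Injective (Aᵀ * A).mulVecLin ↔ Function.Injective A.mulVecLin
  rw [← LinearMap.ker_eq_bot, ← LinearMap.ker_eq_bot, ker_mulVecLin_transpose_mul_self]

variable {n : Type*} [Fintype n] [DecidableEq n]

/-- The Gram determinant of `1, A, …, A ^ (r - 1)` for the bilinear form `tr (A * B)`; for Hermitian
`A` it is a polynomial in the entries that detects whether `A` has at least `r` eigenvalues. -/
def tracePowDet {R : Type*} [CommRing R] (r : ℕ) (A : Matrix n n R) : R :=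
  (of fun i j : Fin r => (A ^ (i + j : ℕ)).trace).det

section CommRing

variable {R S : Type*} [CommRing R] [CommRing S] (r : ℕ)

theorem map_tracePowDet (φ : R →+* S) (A : Matrix n n R) :
    φ (tracePowDet r A) = tracePowDet r (φ.mapMatrix A) := by
  rw [tracePowDet, RingHom.map_det]
  refine congrArg Matrix.det (ext fun i j => ?_)
  rw [RingHom.mapMatrix_apply, map_apply, of_apply, of_apply, ← map_pow, RingHom.mapMatrix_apply,
    ← AddMonoidHom.coe_coe, AddMonoidHom.map_trace, AddMonoidHom.coe_coe]

theorem tracePowDet_smul (c : R) (A : Matrix n n R) :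
    tracePowDet r (c • A) = c ^ (r * (r - 1)) * tracePowDet r A := by
  have hentry : (of fun i j : Fin r => ((c • A) ^ (i + j : ℕ)).trace) =
      of fun i j : Fin r => c ^ (i : ℕ) * (of fun i j : Fin r => c ^ (j : ℕ) *
        (of fun i j : Fin r => (A ^ (i + j : ℕ)).trace) i j) i j := by
    ext i j
    rw [of_apply, smul_pow, trace_smul, smul_eq_mul, pow_add, mul_assoc]
    rfl
  have hprod : ∏ i : Fin r, c ^ (i : ℕ) = c ^ ∑ i ∈ Finset.range r, i := by
    rw [Finset.prod_pow_eq_pow_sum, Fin.sum_univ_eq_sum_range fun i => i]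
  rw [tracePowDet, hentry, det_mul_column, det_mul_row, hprod, ← mul_assoc, ← pow_add, ← mul_two,
    Finset.sum_range_id_mul_two, tracePowDet]

open Polynomial in
theorem eval_tracePowDet_line (A B : Matrix n n R) (t : R) :
    (tracePowDet r (A.map C + (X : R[X]) • B.map C)).eval t = tracePowDet r (A + t • B) := by
  rw [← coe_evalRingHom, map_tracePowDet]
  congr 1
  ext i j
  simp [mul_comm t]

end CommRing

theorem continuous_tracePowDet {R : Type*} [CommRing R] [TopologicalSpace R] [IsTopologicalRing R]
    (r : ℕ) : Continuous (tracePowDet r : Matrix n n R → R) :=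
  Continuous.matrix_det (continuous_matrix fun _ _ => (continuous_id.pow _).matrix_trace)

variable {𝕜 : Type*} [RCLike 𝕜] {A : Matrix n n 𝕜}

theorem trace_pow_eq_sum_eigenvalues_pow (hA : A.IsHermitian) (k : ℕ) :
    (A ^ k).trace = ∑ i, (hA.eigenvalues i : 𝕜) ^ k := by
  conv_lhs => rw [hA.spectral_theorem, ← map_pow, Unitary.conjStarAlgAut_apply, trace_mul_cycle,
    Unitary.coe_star_mul_self, one_mul, diagonal_pow, trace_diagonal]
  rfl

theorem tracePowDet_ne_zero_iff (hA : A.IsHermitian) (r : ℕ) :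
    tracePowDet r A ≠ 0 ↔ r ≤ (spectrum 𝕜 A).ncard := by
  let V : Matrix n (Fin r) ℝ := rectVandermonde hA.eigenvalues 1 r
  have hgram : tracePowDet r A = algebraMap ℝ 𝕜 (Vᵀ * V).det := by
    rw [tracePowDet, RingHom.map_det]
    refine congrArg Matrix.det (ext fun i j => ?_)
    rw [of_apply, trace_pow_eq_sum_eigenvalues_pow hA]
    simp [V, mul_apply, rectVandermonde_apply, pow_add]
  rw [hgram, map_ne_zero, det_transpose_mul_self_ne_zero_iff,
    injective_rectVandermonde_mulVec_iff, hA.spectrum_eq_image_range,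
    Set.ncard_image_of_injective _ RCLike.ofReal_injective]

end TracePowDet

section SplittingEigenvalue

open Module.End

variable {𝕜 E : Type*} [RCLike 𝕜] [NormedAddCommGroup E] [InnerProductSpace 𝕜 E]
  {T : Module.End 𝕜 E} {W : Submodule 𝕜 E} [W.HasOrthogonalProjection] {μ ν : 𝕜}

theorem hasEigenvalue_add_smul_starProjection_add (hle : W ≤ eigenspace T μ) (hbot : W ≠ ⊥)
    (c : 𝕜) : HasEigenvalue (T + c • W.starProjection.toLinearMap) (μ + c) := by
  obtain ⟨w, hw, hw0⟩ := W.exists_mem_ne_zero_of_ne_bot hbot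
  refine hasEigenvalue_of_hasEigenvector (x := w) ⟨mem_eigenspace_iff.2 ?_, hw0⟩
  simp [mem_eigenspace_iff.1 (hle hw), W.starProjection_eq_self_iff.2 hw, add_smul]

theorem hasEigenvalue_add_smul_starProjection_of_mem_orthogonal {v : E} (hv : HasEigenvector T ν v)
    (hvW : v ∈ Wᗮ) (c : 𝕜) : HasEigenvalue (T + c • W.starProjection.toLinearMap) ν := by
  refine hasEigenvalue_of_hasEigenvector (x := v) ⟨mem_eigenspace_iff.2 ?_, hv.2⟩
  simp [hv.apply_eq_smul, W.starProjection_apply_eq_zero_iff.2 hvW]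

theorem hasEigenvalue_add_smul_starProjection_of_lt (hlt : W < eigenspace T μ) (c : 𝕜) :
    HasEigenvalue (T + c • W.starProjection.toLinearMap) μ := by
  obtain ⟨v, hv, hvW⟩ := SetLike.exists_of_lt hlt
  have hproj : W.starProjection v ∈ W := W.starProjection_apply_mem v
  refine hasEigenvalue_add_smul_starProjection_of_mem_orthogonal (v := v - W.starProjection v)
    ⟨sub_mem hv (hlt.le hproj), fun h => hvW ?_⟩ (W.sub_starProjection_mem_orthogonal v) c
  rwa [sub_eq_zero.1 h]

theorem hasEigenvalue_add_smul_starProjection_of_ne (hT : T.IsSymmetric)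
    (hle : W ≤ eigenspace T μ) (hne : μ ≠ ν) (hν : HasEigenvalue T ν) (c : 𝕜) :
    HasEigenvalue (T + c • W.starProjection.toLinearMap) ν := by
  obtain ⟨v, hv⟩ := hν.exists_hasEigenvector
  exact hasEigenvalue_add_smul_starProjection_of_mem_orthogonal hv
    (fun w hw => hT.orthogonalFamily_eigenspaces hne ⟨w, hle hw⟩ ⟨v, hv.1⟩) c

theorem exists_ncard_spectrum_lt_add_smul_starProjection [FiniteDimensional 𝕜 E]
    (hT : T.IsSymmetric) (hlt : W < eigenspace T μ) (hbot : W ≠ ⊥) :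
    ∃ c : ℝ, (spectrum 𝕜 T).ncard <
      (spectrum 𝕜 (T + (c : 𝕜) • W.starProjection.toLinearMap)).ncard := by
  obtain ⟨c, hc⟩ : ∃ c : ℝ, μ + c ∉ spectrum 𝕜 T :=
    ((finite_spectrum T).preimage
      ((add_right_injective μ).comp RCLike.ofReal_injective).injOn).exists_notMem
  refine ⟨c, Set.ncard_lt_ncard ((Set.ssubset_iff_of_subset fun ν hν => ?_).2
    ⟨μ + c, ?_, hc⟩) (finite_spectrum _)⟩
  · rw [← hasEigenvalue_iff_mem_spectrum] at hν ⊢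
    rcases eq_or_ne μ ν with rfl | hne
    · exact hasEigenvalue_add_smul_starProjection_of_lt hlt c
    · exact hasEigenvalue_add_smul_starProjection_of_ne hT hlt.le hne hν c
  · exact hasEigenvalue_iff_mem_spectrum.1
      (hasEigenvalue_add_smul_starProjection_add hlt.le hbot c)

end SplittingEigenvalue

section Kappa

theorem kappa_mul_apply (ε δ : ℤˣ) (z : ℂ) : kappa (ε * δ) z = kappa ε (kappa δ z) := by
  rcases Int.units_eq_one_or ε with rfl | rfl <;> rcases Int.units_eq_one_or δ with rfl | rfl <;>
    simp [kappa]

theorem kappa_star (ε : ℤˣ) (z : ℂ) : kappa ε (star z) = star (kappa ε z) := by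
  rcases Int.units_eq_one_or ε with rfl | rfl <;> simp [kappa]

theorem kappa_ofReal (ε : ℤˣ) (r : ℝ) : kappa ε (r : ℂ) = r :=
  (kappa ε).commutes r

end Kappa

namespace UnitaryCoRep

variable {G : Type*} [Group G] {s : G →* ℤˣ} {ω : FactorSystem s}
  {n : Type*} [Fintype n] [DecidableEq n]

section Operators

open Matrix

variable (M : UnitaryCoRep ω n) (g h : G)

theorem op_apply (v : EuclideanSpace ℂ n) (i : n) :
    M.op g v i = ∑ j, M.mat g i j * kappa (s g) (v j) := rfl

theorem op_smul (c : ℂ) (v : EuclideanSpace ℂ n) :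
    M.op g (c • v) = kappa (s g) c • M.op g v := by
  ext i
  simp only [op_apply, PiLp.smul_apply, smul_eq_mul, map_mul, Finset.mul_sum]
  exact Finset.sum_congr rfl fun j _ => mul_left_comm _ _ _

theorem op_op (v : EuclideanSpace ℂ n) :
    M.op g (M.op h v) = (ω.toFun g h : ℂ) • M.op (g * h) v := by
  ext i
  have hmul (k : n) : ∑ j, M.mat g i j * kappa (s g) (M.mat h j k) =
      (ω.toFun g h : ℂ) * M.mat (g * h) i k := by
    simpa [mul_apply] using congrFun₂ (M.mul_kappa g h) i k
  calc M.op g (M.op h v) i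
      = ∑ k, ∑ j, M.mat g i j * kappa (s g) (M.mat h j k) * kappa (s (g * h)) (v k) := by
        simp only [op_apply, map_sum, map_mul, Finset.mul_sum, kappa_mul_apply, mul_assoc]
        exact Finset.sum_comm
    _ = ((ω.toFun g h : ℂ) • M.op (g * h) v) i := by
        simp only [← Finset.sum_mul, hmul]
        simp only [PiLp.smul_apply, op_apply, smul_eq_mul, Finset.mul_sum, mul_assoc]

theorem conjTranspose_mat_mul_mat : (M.mat g)ᴴ * M.mat g = 1 :=
  mem_unitaryGroup_iff'.1 (M.unitary g)

theorem inner_op_op (v w : EuclideanSpace ℂ n) :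
    inner ℂ (M.op g v) (M.op g w) = kappa (s g) (inner ℂ v w) := by
  have hop (u : EuclideanSpace ℂ n) : (M.op g u).ofLp = M.mat g *ᵥ fun i => kappa (s g) (u i) := rfl
  rw [EuclideanSpace.inner_eq_star_dotProduct, EuclideanSpace.inner_eq_star_dotProduct, hop, hop,
    star_mulVec, dotProduct_comm, ← dotProduct_mulVec, mulVec_mulVec, conjTranspose_mat_mul_mat,
    one_mulVec, dotProduct_comm]
  simp only [dotProduct, map_sum, map_mul, Pi.star_apply, kappa_star]

theorem conjBy_apply_op (A : Matrix n n ℂ) (v : EuclideanSpace ℂ n) :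
    toEuclideanLin (M.conjBy g A) (M.op g v) = M.op g (toEuclideanLin A v) := by
  rw [conjBy_apply, LinearEquiv.symm_apply_apply]

theorem conjBy_eq_self_iff (A : Matrix n n ℂ) :
    M.conjBy g A = A ↔ ∀ v, toEuclideanLin A (M.op g v) = M.op g (toEuclideanLin A v) := by
  refine ⟨fun hA v => by rw [← conjBy_apply_op, hA], fun hA => ?_⟩
  refine toEuclideanLin.injective (LinearMap.ext fun v => ?_)
  rw [conjBy_apply, ← hA, LinearEquiv.apply_symm_apply]

theorem conjBy_conjBy (A : Matrix n n ℂ) : M.conjBy g (M.conjBy h A) = M.conjBy (g * h) A := by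
  refine toEuclideanLin.injective (LinearMap.ext fun v => ?_)
  obtain ⟨u, rfl⟩ := (M.op g).surjective v
  obtain ⟨w, rfl⟩ := (M.op h).surjective u
  -- `op g (op h w)` is a multiple of `op (g * h) w`, and the phase cancels by complex linearity.
  rw [conjBy_apply_op, conjBy_apply_op, op_op, op_op, map_smul, conjBy_apply_op]

theorem isLinearMap_conjBy : IsLinearMap ℝ (M.conjBy g) where
  map_add A B := by
    simp only [conjBy, Matrix.map_add _ (map_add (kappa (s g))), mul_add, add_mul]
  map_smul c A := by
    simp only [conjBy, Matrix.map_smul _ c (kappa_smul (s g) c), Matrix.mul_smul,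
      Matrix.smul_mul]

theorem isHermitian_conjBy {A : Matrix n n ℂ} (hA : A.IsHermitian) :
    (M.conjBy g A).IsHermitian := by
  have hmap : (A.map (kappa (s g))).IsHermitian := hA.map _ (kappa_star (s g))
  rw [conjBy, inv_eq_left_inv (M.conjTranspose_mat_mul_mat g)]
  exact isHermitian_mul_mul_conjTranspose _ hmap

end Operators

section Hamiltonian

variable [Fintype G] (M : UnitaryCoRep ω n)

theorem isHermitian_hamiltonian (X : Matrix n n ℂ) : (M.hamiltonian X).IsHermitian := by
  rw [hamiltonian, Matrix.IsHermitian, Matrix.conjTranspose_sum]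
  exact Finset.sum_congr rfl fun g _ =>
    M.isHermitian_conjBy g (Matrix.isHermitian_add_transpose_self X)

theorem conjBy_hamiltonian (g : G) (X : Matrix n n ℂ) :
    M.conjBy g (M.hamiltonian X) = M.hamiltonian X := by
  calc M.conjBy g (∑ h, M.conjBy h (X + X.conjTranspose))
      = ∑ h, M.conjBy g (M.conjBy h (X + X.conjTranspose)) :=
        map_sum ((M.isLinearMap_conjBy g).mk' _) _ _
    _ = ∑ h, M.conjBy (g * h) (X + X.conjTranspose) := by simp only [conjBy_conjBy]
    _ = M.hamiltonian X :=
        Fintype.sum_equiv (Equiv.mulLeft g) _ _ fun _ => rfl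

theorem hamiltonian_apply_op (X : Matrix n n ℂ) (g : G) (v : EuclideanSpace ℂ n) :
    Matrix.toEuclideanLin (M.hamiltonian X) (M.op g v) =
      M.op g (Matrix.toEuclideanLin (M.hamiltonian X) v) :=
  (M.conjBy_eq_self_iff g _).1 (M.conjBy_hamiltonian g X) v

theorem isLinearMap_hamiltonian : IsLinearMap ℝ M.hamiltonian where
  map_add X Y := by
    simp only [hamiltonian, ← Finset.sum_add_distrib, ← (M.isLinearMap_conjBy _).map_add,
      Matrix.conjTranspose_add, add_add_add_comm]
  map_smul c X := by
    simp only [hamiltonian, Finset.smul_sum, ← (M.isLinearMap_conjBy _).map_smul, smul_add,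
      Matrix.conjTranspose_smul, star_trivial]

theorem hamiltonian_eq_smul {H : Matrix n n ℂ} (hH : H.IsHermitian)
    (hinv : ∀ g, M.conjBy g H = H) : M.hamiltonian H = (2 * Fintype.card G : ℝ) • H := by
  simp only [hamiltonian, hH.eq, (M.isLinearMap_conjBy _).map_add, hinv, Finset.sum_const,
    Finset.card_univ]
  rw [← two_smul ℝ H, ← Nat.cast_smul_eq_nsmul ℝ, smul_smul, mul_comm]

theorem range_hamiltonian :
    Set.range M.hamiltonian = {H | H.IsHermitian ∧ ∀ g, M.conjBy g H = H} := by
  refine Set.Subset.antisymm ?_ fun H ⟨hH, hinv⟩ => ⟨(2 * Fintype.card G : ℝ)⁻¹ • H, ?_⟩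
  · rintro _ ⟨X, rfl⟩
    exact ⟨M.isHermitian_hamiltonian X, fun g => M.conjBy_hamiltonian g X⟩
  · rw [M.isLinearMap_hamiltonian.map_smul, M.hamiltonian_eq_smul hH hinv,
      inv_smul_smul₀ (by simp)]

end Hamiltonian

section Restriction

variable (M : UnitaryCoRep ω n)

/-- A complex subspace of `ℂⁿ` invariant under all operators `M(g)κ_{s(g)}`. -/
def IsInvariant (W : Submodule ℂ (EuclideanSpace ℂ n)) : Prop :=
  ∀ g, ∀ v ∈ W, M.op g v ∈ W

variable {M} {W : Submodule ℂ (EuclideanSpace ℂ n)}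

theorem IsInvariant.exists_op_eq (hW : M.IsInvariant W) (g : G) {w : EuclideanSpace ℂ n}
    (hw : w ∈ W) : ∃ u ∈ W, M.op g u = w := by
  let W' : Submodule ℝ (EuclideanSpace ℂ n) := W.restrictScalars ℝ
  have hle : W'.map (M.op g).toLinearMap ≤ W' := by
    rintro _ ⟨v, hv, rfl⟩
    exact hW g v hv
  have heq := Submodule.eq_of_le_of_finrank_eq hle (LinearEquiv.finrank_map_eq (M.op g) W')
  exact heq.ge hw

theorem IsInvariant.orthogonal (hW : M.IsInvariant W) : M.IsInvariant Wᗮ := by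
  intro g v hv w hw
  obtain ⟨u, hu, rfl⟩ := hW.exists_op_eq g hw
  rw [inner_op_op, hv u hu, map_zero]

theorem IsInvariant.starProjection_op (hW : M.IsInvariant W) (g : G) (v : EuclideanSpace ℂ n) :
    W.starProjection (M.op g v) = M.op g (W.starProjection v) := by
  refine Submodule.eq_starProjection_of_mem_orthogonal
    (hW g _ (W.starProjection_apply_mem v)) ?_
  rw [← map_sub]
  exact hW.orthogonal g _ (W.sub_starProjection_mem_orthogonal v)

variable {m : Type*} [Fintype m]

theorem IsInvariant.sum_inner_smul (hW : M.IsInvariant W) (b : OrthonormalBasis m ℂ W) (g : G)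
    {v : EuclideanSpace ℂ n} (hv : v ∈ W) :
    ∑ i, inner ℂ (b i : EuclideanSpace ℂ n) (M.op g v) • (b i : EuclideanSpace ℂ n) =
      M.op g v := by
  simpa using congrArg Subtype.val (b.sum_repr' ⟨M.op g v, hW g v hv⟩)

variable [DecidableEq m]

/-- The (co-)representation that `M` induces on an invariant subspace `W`, written in an
orthonormal basis of `W`. -/
noncomputable def IsInvariant.restrict (hW : M.IsInvariant W) (b : OrthonormalBasis m ℂ W) :
    UnitaryCoRep ω m where
  mat g := Matrix.of fun i j => inner ℂ (b i : EuclideanSpace ℂ n) (M.op g (b j))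
  unitary g := by
    rw [Matrix.mem_unitaryGroup_iff']
    ext j k
    have hparseval :=
      b.sum_inner_mul_inner ⟨M.op g (b j), hW g _ (b j).2⟩ ⟨M.op g (b k), hW g _ (b k).2⟩
    simp only [Submodule.coe_inner, inner_op_op] at hparseval
    simp only [Matrix.star_eq_conjTranspose, Matrix.mul_apply, Matrix.conjTranspose_apply,
      Matrix.of_apply, RCLike.star_def, inner_conj_symm, hparseval, ← Submodule.coe_inner,
      orthonormal_iff_ite.1 b.orthonormal j k, Matrix.one_apply]
    split_ifs
    · exact map_one _
    · exact map_zero _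
  mul_kappa g h := by
    ext i k
    have hexpand := congrArg (fun v => inner ℂ (b i : EuclideanSpace ℂ n) (M.op g v))
      (hW.sum_inner_smul b h (b k).2)
    simp only [map_sum, op_smul, inner_sum, inner_smul_right, op_op] at hexpand
    simpa only [Matrix.mul_apply, Matrix.of_apply, Matrix.map_apply, Matrix.smul_apply,
      smul_eq_mul, mul_comm] using hexpand

theorem IsInvariant.op_basis (hW : M.IsInvariant W) (b : OrthonormalBasis m ℂ W) (g : G) (j : m) :
    M.op g (b j : EuclideanSpace ℂ n) =
      ∑ i, (hW.restrict b).mat g i j • (b i : EuclideanSpace ℂ n) :=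
  (hW.sum_inner_smul b g (b j).2).symm

theorem IsInvariant.op_repr_symm (hW : M.IsInvariant W) (b : OrthonormalBasis m ℂ W) (g : G)
    (x : EuclideanSpace ℂ m) :
    M.op g (b.repr.symm x : EuclideanSpace ℂ n) = b.repr.symm ((hW.restrict b).op g x) := by
  simp only [← b.sum_repr_symm, Submodule.coe_sum, Submodule.coe_smul, map_sum, op_smul,
    hW.op_basis b, op_apply, Finset.smul_sum, Finset.sum_smul, smul_smul]
  rw [Finset.sum_comm]
  simp only [mul_comm]

theorem isIrreducible_restrict_of_minimal (hmin : Minimal (fun V => V ≠ ⊥ ∧ M.IsInvariant V) W)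
    (b : OrthonormalBasis m ℂ W) : (hmin.prop.2.restrict b).IsIrreducible := by
  constructor
  · have : Nontrivial W := Submodule.nontrivial_iff_ne_bot.2 hmin.prop.1
    exact b.toBasis.index_nonempty
  · intro V hV
    let f : EuclideanSpace ℂ m →ₗ[ℂ] EuclideanSpace ℂ n :=
      W.subtype ∘ₗ b.repr.symm.toLinearEquiv.toLinearMap
    have hf : Function.Injective f := W.injective_subtype.comp b.repr.symm.injective
    have hinv : M.IsInvariant (V.map f) := by
      rintro g _ ⟨x, hx, rfl⟩
      exact ⟨_, hV g x hx, (hmin.prop.2.op_repr_symm b g x).symm⟩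
    have hle : V.map f ≤ W := by
      rintro _ ⟨x, -, rfl⟩
      exact (b.repr.symm x).2
    refine or_iff_not_imp_left.2 fun hbot => eq_top_iff.2 fun x _ => ?_
    have hne : V.map f ≠ ⊥ := fun h =>
      hbot (Submodule.map_injective_of_injective hf (h.trans (Submodule.map_bot f).symm))
    have hge : W ≤ V.map f := hmin.le_of_le ⟨hne, hinv⟩ hle
    exact hf.mem_set_image.1 (hge (b.repr.symm x).2)

theorem isContainedIn_of_op_basis {l : ℕ} {N : UnitaryCoRep ω m} {N' : UnitaryCoRep ω (Fin l)}
    (B : OrthonormalBasis (m ⊕ Fin l) ℂ (EuclideanSpace ℂ n))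
    (hN : ∀ g j, M.op g (B (.inl j)) = ∑ i, N.mat g i j • B (.inl i))
    (hN' : ∀ g j, M.op g (B (.inr j)) = ∑ i, N'.mat g i j • B (.inr i)) :
    N.IsContainedIn M := by
  let e := EuclideanSpace.basisFun n ℂ
  refine ⟨l, N', e.toBasis.toMatrix B, e.toMatrix_orthonormalBasis_conjTranspose_mul_self B,
    e.toMatrix_orthonormalBasis_self_mul_conjTranspose B, fun g => ?_⟩
  ext i j
  have hcol : (M.mat g * (e.toBasis.toMatrix B).map (kappa (s g))) i j = M.op g (B j) i := rfl
  rw [hcol]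
  cases j with
  | inl j => simp [hN, e, Matrix.mul_apply, Module.Basis.toMatrix_apply, mul_comm]
  | inr j => simp [hN', e, Matrix.mul_apply, Module.Basis.toMatrix_apply, mul_comm]

theorem IsInvariant.isContainedIn_restrict (hW : M.IsInvariant W) (b : OrthonormalBasis m ℂ W) :
    (hW.restrict b).IsContainedIn M := by
  let c := stdOrthonormalBasis ℂ Wᗮ
  let B := (b.prod c).map W.orthogonalDecomposition.symm
  have hinl (j) : B (.inl j) = b j := by simp [B]
  have hinr (j) : B (.inr j) = c j := by simp [B]
  refine isContainedIn_of_op_basis (N' := hW.orthogonal.restrict c) B (fun g j => ?_) fun g j => ?_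
  · simpa only [hinl] using hW.op_basis b g j
  · simpa only [hinr] using hW.orthogonal.op_basis c g j

end Restriction

section MaximalSpectrum

open Matrix Module.End MeasureTheory

theorem isInvariant_eigenspace_ofReal {M : UnitaryCoRep ω n} {A : Matrix n n ℂ}
    (hA : ∀ g, M.conjBy g A = A) (x : ℝ) :
    M.IsInvariant (eigenspace (toEuclideanLin A) (x : ℂ)) := by
  intro g v hv
  rw [mem_eigenspace_iff] at hv ⊢
  rw [(M.conjBy_eq_self_iff g A).1 (hA g), hv, op_smul, kappa_ofReal]

theorem IsInvariant.conjBy_starProjection {M : UnitaryCoRep ω n}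
    {W : Submodule ℂ (EuclideanSpace ℂ n)} (hW : M.IsInvariant W) (g : G) :
    M.conjBy g (toEuclideanLin.symm W.starProjection.toLinearMap) =
      toEuclideanLin.symm W.starProjection.toLinearMap := by
  rw [conjBy_eq_self_iff, LinearEquiv.apply_symm_apply]
  exact hW.starProjection_op g

variable [Fintype G] (M : UnitaryCoRep ω n)

theorem exists_hamiltonian_eq_add_smul_starProjection (X : Matrix n n ℂ)
    {W : Submodule ℂ (EuclideanSpace ℂ n)} (hW : M.IsInvariant W) (c : ℝ) :
    ∃ Y, toEuclideanLin (M.hamiltonian Y) =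
      toEuclideanLin (M.hamiltonian X) + (c : ℂ) • W.starProjection.toLinearMap := by
  let P := toEuclideanLin.symm W.starProjection.toLinearMap
  have hP : P.IsHermitian := by
    rw [← isSymmetric_toEuclideanLin_iff, LinearEquiv.apply_symm_apply]
    exact W.starProjection_isSymmetric
  obtain ⟨Y, hY⟩ : M.hamiltonian X + c • P ∈ Set.range M.hamiltonian := by
    rw [range_hamiltonian]
    refine ⟨(M.isHermitian_hamiltonian X).add (hP.smul (IsSelfAdjoint.all c)), fun g => ?_⟩
    rw [(M.isLinearMap_conjBy g).map_add, (M.isLinearMap_conjBy g).map_smul, conjBy_hamiltonian,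
      hW.conjBy_starProjection]
  refine ⟨Y, ?_⟩
  rw [hY, map_add, ← Complex.coe_smul, map_smul, LinearEquiv.apply_symm_apply]

variable {M} in
theorem minimal_eigenspace_of_forall_ncard_spectrum_le {X : Matrix n n ℂ}
    (hX : ∀ Y, (spectrum ℂ (M.hamiltonian Y)).ncard ≤ (spectrum ℂ (M.hamiltonian X)).ncard)
    {μ : ℂ} (hμ : HasEigenvalue (toEuclideanLin (M.hamiltonian X)) μ) :
    Minimal (fun W => W ≠ ⊥ ∧ M.IsInvariant W)
      (eigenspace (toEuclideanLin (M.hamiltonian X)) μ) := by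
  have hT := isSymmetric_toEuclideanLin_iff.2 (M.isHermitian_hamiltonian X)
  obtain ⟨x, rfl⟩ := Complex.conj_eq_iff_real.1 (hT.conj_eigenvalue_eq_self hμ)
  refine ⟨⟨hμ, isInvariant_eigenspace_ofReal (fun g => M.conjBy_hamiltonian g X) x⟩, ?_⟩
  rintro W ⟨hbot, hW⟩ hle
  by_contra hge
  obtain ⟨c, hc⟩ := exists_ncard_spectrum_lt_add_smul_starProjection hT
    (lt_of_le_not_ge hle hge) hbot
  obtain ⟨Y, hY⟩ := M.exists_hamiltonian_eq_add_smul_starProjection X hW c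
  refine (hX Y).not_gt ?_
  have hspec (A : Matrix n n ℂ) : spectrum ℂ (toEuclideanLin A) = spectrum ℂ A := spectrum_toLpLin 2
  rwa [← hspec, ← hspec, hY]

theorem ncard_spectrum_hamiltonian_le_card (X : Matrix n n ℂ) :
    (spectrum ℂ (M.hamiltonian X)).ncard ≤ Fintype.card n := by
  rw [(M.isHermitian_hamiltonian X).spectrum_eq_image_range,
    Set.ncard_image_of_injective _ RCLike.ofReal_injective, ← Set.image_univ,
    ← Nat.card_eq_fintype_card, ← Set.ncard_univ]
  exact Set.ncard_image_le Set.finite_univ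

theorem exists_forall_ncard_spectrum_hamiltonian_le :
    ∃ X, ∀ Y, (spectrum ℂ (M.hamiltonian Y)).ncard ≤ (spectrum ℂ (M.hamiltonian X)).ncard := by
  have hbdd : BddAbove (Set.range fun Y => (spectrum ℂ (M.hamiltonian Y)).ncard) := by
    refine ⟨Fintype.card n, ?_⟩
    rintro _ ⟨Y, rfl⟩
    exact M.ncard_spectrum_hamiltonian_le_card Y
  obtain ⟨X, hX⟩ := Nat.sSup_mem (Set.range_nonempty _) hbdd
  exact ⟨X, fun Y => (le_csSup hbdd ⟨Y, rfl⟩).trans_eq hX.symm⟩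

theorem ae_tracePowDet_hamiltonian_ne_zero {r : ℕ} {X₀ : Matrix n n ℂ}
    (hX₀ : tracePowDet r (M.hamiltonian X₀) ≠ 0) :
    ∀ᵐ X : n → n → ℂ ∂volume, tracePowDet r (M.hamiltonian (of X)) ≠ 0 := by
  have hlin := M.isLinearMap_hamiltonian
  have hcont : Continuous fun X : n → n → ℂ => tracePowDet r (M.hamiltonian (of X)) :=
    (continuous_tracePowDet r).comp (hlin.mk' _).continuous_of_finiteDimensional
  have : (volume : Measure (n → n → ℂ)).IsAddHaarMeasure :=
    Measure.pi.isAddHaarMeasure fun _ : n => (volume : Measure (n → ℂ))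
  refine ae_ne_zero_of_homogeneous_of_polynomial_on_lines volume
    (isOpen_ne_fun hcont continuous_const).measurableSet (N := r * (r - 1)) (fun c X => ?_)
    (fun X Y => ⟨_, fun t => (eval_tracePowDet_line r (M.hamiltonian (of X))
      (M.hamiltonian (of Y)) (t : ℂ)).trans ?_⟩) (v := of.symm X₀) hX₀
  · rw [← smul_of, hlin.map_smul, ← Complex.coe_smul, tracePowDet_smul]
    rfl
  · rw [← of_add_of, ← smul_of, hlin.map_add, hlin.map_smul, Complex.coe_smul]

theorem ae_forall_ncard_spectrum_hamiltonian_le :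
    ∀ᵐ X : n → n → ℂ ∂volume, ∀ Y, (spectrum ℂ (M.hamiltonian Y)).ncard ≤
      (spectrum ℂ (M.hamiltonian (of X))).ncard := by
  obtain ⟨X₀, hX₀⟩ := M.exists_forall_ncard_spectrum_hamiltonian_le
  have hne := (tracePowDet_ne_zero_iff (M.isHermitian_hamiltonian X₀) _).2 le_rfl
  filter_upwards [M.ae_tracePowDet_hamiltonian_ne_zero hne] with X hX Y
  exact (hX₀ Y).trans ((tracePowDet_ne_zero_iff (M.isHermitian_hamiltonian _) _).1 hX)

end MaximalSpectrum

end UnitaryCoRep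

theorem theorem1 {G : Type*} [Group G] [Fintype G] (s : G →* ℤˣ) (ω : FactorSystem s)
    (d : ℕ) (M : UnitaryCoRep ω (Fin d)) :
    (∀ X : Matrix (Fin d) (Fin d) ℂ,
      (M.hamiltonian X).IsHermitian ∧
      ∀ (g : G) (v : EuclideanSpace ℂ (Fin d)),
        Matrix.toEuclideanLin (M.hamiltonian X) (M.op g v) =
          M.op g (Matrix.toEuclideanLin (M.hamiltonian X) v)) ∧
    ∀ᵐ X : Fin d → Fin d → ℂ ∂MeasureTheory.volume,
      ∀ μ : ℂ,
        Module.End.HasEigenvalue (Matrix.toEuclideanLin (M.hamiltonian (Matrix.of X))) μ →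
        ∀ (k : ℕ) (b : OrthonormalBasis (Fin k) ℂ
            (Module.End.eigenspace (Matrix.toEuclideanLin (M.hamiltonian (Matrix.of X))) μ)),
          ∃ N : UnitaryCoRep ω (Fin k),
            (∀ (g : G) (j : Fin k),
              M.op g (b j : EuclideanSpace ℂ (Fin d)) =
                ∑ i, N.mat g i j • (b i : EuclideanSpace ℂ (Fin d))) ∧
            N.IsIrreducible ∧ N.IsContainedIn M := by
  refine ⟨fun X => ⟨M.isHermitian_hamiltonian X, M.hamiltonian_apply_op X⟩, ?_⟩
  filter_upwards [M.ae_forall_ncard_spectrum_hamiltonian_le] with X hX μ hμ k b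
  have hmin := UnitaryCoRep.minimal_eigenspace_of_forall_ncard_spectrum_le hX hμ
  have hinv := hmin.prop.2
  exact ⟨hinv.restrict b, hinv.op_basis b,
    UnitaryCoRep.isIrreducible_restrict_of_minimal hmin b, hinv.isContainedIn_restrict b⟩
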